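/- Conventions. For a graph $G$ and disjoint vertex sets $A,B$, $(A,B)_G$ is the bipartite subgraph of $G$ with classes $A,B$ and all edges of $G$ between them, and $d_G(A,B)=e_G(A,B)/(|A||B|)$. It is $\varepsilon$-regular if $|d_G(X,Y)-d_G(A,B)|<\varepsilon$ for all $X\subseteq A$, $Y\subseteq B$ with $|X|\ge\varepsilon|A|$, $|Y|\ge\varepsilon|B|$; it is $(\varepsilon,d)$-super-regular if moreover every $a\in A$ has at least $d|B|$ neighbours in $B$ and every $b\in B$ has at least $d|A|$ neighbours in $A$. Given an integer $m$, a pair $(A,B)$ of vertex sets is weakly $(\varepsilon,\varepsilon')$-regular in $H$ if for all $S\subseteq A$, $T\subseteq B$ with $|S|,|T|\ge\varepsilon m$ there are at least $\varepsilon' m^2$ edges of $H$ between $S$ and $T$. Theorem. There is a function $f:(0,\infty)\to(0,\infty)$ such that the following holds for all reals $\alpha,\gamma,\beta,\varepsilon>0$ and all positive integers $k,n$ with $$\gamma\le f(\alpha),\quad \beta\le f(\gamma),\quad \varepsilon\le f(\beta),\quad \tfrac1k\le\varepsilon,\quad \tfrac1n\le f\!\left(\tfrac1k\right)$$ (that is,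 $1/n\ll 1/k\le\varepsilon\ll\beta\ll\gamma\ll\alpha$). Let $m$ be an integer such that $(1-\varepsilon)n\le mk\le n$. Let $H$ be a graph on $n$ vertices and let $F$ be a $2$-factor (a spanning $2$-regular graph) on the same vertex set such that $F$ and $H$ are edge-disjoint. Let $X:=F\cup H$. Let $A_1,\dots,A_k$ be disjoint sets of vertices of $X$, each of size $(1-2\varepsilon)m$ (rounded up or down to an integer), and let $B_1,\dots,B_{k'},D_1,\dots,D_{k'}$ be another enumeration of $A_1,\dots,A_k$ (so $k=2k'$). Suppose that: (i) $F$ contains at most $n/(\log n)^{1/5}$ cycles; (ii) for every $1\le i\le k'$ and every vertex $b\in B_i$, the number of $H$-neighbours of $b$ in $D_i$ that have an $F$-neighbour outside $B_i$ is at most $2\gamma^3\beta m$, and for every vertex $d\in D_i$, the number of $H$-neighbours of $d$ in $B_i$ that have an $F$-neighbour outside $D_i$ is at most $2\gamma^3\beta m$; (iii) for every $1\le i\le k'$, the pair $(B_i,D_i)_H$ is $(3\varepsilon,\gamma\beta/6)$-super-regular; (iv) for every $1\le i\le k$ there are at least $(1+\alpha)k'$ distinct $j$ with $1\le j\le k$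 such that $(A_i,A_j)$ is weakly $(\varepsilon,\varepsilon^3/k)$-regular in $H$; (v) for all $1\le i<j\le k$, if $X$ has an edge between $A_i$ and $A_j$, then $(A_i,A_j)$ is weakly $(\varepsilon,\varepsilon^3/k)$-regular in $H$; (vi) for every vertex $x\notin A_1\cup\dots\cup A_k$, both $F$-neighbours of $x$ belong to $A_1\cup\dots\cup A_k$; (vii) every vertex $x\notin A_1\cup\dots\cup A_k$ has degree at least $\alpha n/6$ in $H$, and every $H$-neighbour of $x$ lies in $A_1\cup\dots\cup A_k$. Then there is a Hamilton cycle $C$ of $X$ with $|E(C)\triangle E(F)|\le 25n/(\log n)^{1/5}$. -/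

import Mathlib

/-- The bipartite subgraph of `G` spanned by the disjoint vertex sets `A` and `B` is
`(ε, d)`-super-regular: it is `ε`-regular (that is, `|d(X, Y) - d(A, B)| < ε` for all `X ⊆ A`,
`Y ⊆ B` with `|X| ≥ ε |A|`, `|Y| ≥ ε |B|`), every vertex of `A` has at least `d |B|` neighbours
in `B`, and every vertex of `B` has at least `d |A|` neighbours in `A`. -/
def IsSuperRegularPair {V : Type*} [DecidableEq V] (G : SimpleGraph V) [DecidableRel G.Adj]
    (ε d : ℝ) (A B : Finset V) : Prop :=
  G.IsUniform ε A B ∧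
    (∀ a ∈ A, d * (B.card : ℝ) ≤ ((B.filter fun b => G.Adj a b).card : ℝ)) ∧
    (∀ b ∈ B, d * (A.card : ℝ) ≤ ((A.filter fun a => G.Adj b a).card : ℝ))

/-- The pair `(A, B)` is weakly `(ε, ε')`-regular in `G` (with respect to the cluster size
parameter `m`): there are at least `ε' m ^ 2` edges of `G` between any `S ⊆ A` and `T ⊆ B` of size
at least `ε m`. -/
def IsWeaklyRegularPair {V : Type*} [DecidableEq V] (G : SimpleGraph V) [DecidableRel G.Adj]
    (m : ℕ) (ε ε' : ℝ) (A B : Finset V) : Prop :=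
  ∀ S ⊆ A, ∀ T ⊆ B, ε * (m : ℝ) ≤ (S.card : ℝ) → ε * (m : ℝ) ≤ (T.card : ℝ) →
    ε' * (m : ℝ) ^ 2 ≤ ((G.interedges S T).card : ℝ)

/-! The Hamilton cycle is built by absorbing the components of the 2-factor `F` one at a time, with
Pósa rotations along edges of `H`. The objects are paths of `F ∪ H` whose vertex set is a union of
components of `F` (`IsClosedPath`), kept as lists. Only the number of steps of such a path that are
not edges of `F` is recorded (`defect`). This suffices, since a Hamilton cycle has as many edges as
`F`, so that its symmetric difference with `F` is twice the number of its edges outside `F`.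

Write `A_i*` for the partner of the cluster `A_i` in the pairing `(B_j, D_j)`. As each vertex has
few neighbours in the partner cluster with an `F`-neighbour outside its own cluster,
super-regularity implies that all but a small proportion of the vertices of a cluster have both
`F`-neighbours in the partner cluster. So a rotation through a vertex of `A_j` usually makes a
vertex of `A_j*` the new first vertex; the exceptions caused by non-`F` steps are at most `defect`
many, which is negligible because `F` has so few components. Suppose that no rotation of the path
has a first vertex with a neighbour off the path (otherwise a further component of `F` is absorbed).

* One rotation reaches linearly many first vertices in one cluster `A_a` that depends only on the
  old first vertex (`exists_many_rotations`).
* A second rotation reaches `A_j*` for each `A_j` that is weakly regular with `A_a`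
  (`IsClusterSystem.rotate_twice`). These are more than half of the clusters. Applied to both ends,
  this allows the ends to be moved into clusters `A_x` and `A_x*`.
* Super-regularity of `(A_x, A_x*)` then closes the path to a cycle after two more rotations
  (`IsClusterSystem.exists_cycle`).

If the cycle is not spanning, an edge of `H` leaves its vertex set
(`IsClusterSystem.exists_leaving_edge`) and the cycle, opened at this edge, extends to a longer
path. Each absorbed component costs at most eight non-`F` steps
(`IsClusterSystem.hamiltonian_or_longer`), so that the final cycle differs from `F` in at most `16`
edges per component of `F`. -/

/-! ### Lists as paths, and their non-`F` steps -/

section Lists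

variable {V : Type*} (F : SimpleGraph V) [DecidableRel F.Adj]

/-- The list of those entries of a vertex sequence that are not joined by an edge of `F` to the
entry just before them. -/
def jumps : List V → List V
  | a :: b :: l => if F.Adj a b then jumps (b :: l) else b :: jumps (b :: l)
  | _ => []

/-- The number of consecutive pairs of a vertex sequence that are not edges of `F`. -/
def defect (p : List V) : ℕ := (jumps F p).length

lemma defect_cons_cons (a b : V) (l : List V) :
    defect F (a :: b :: l) = (if F.Adj a b then 0 else 1) + defect F (b :: l) := by
  unfold defect
  rw [jumps]
  split_ifs <;> simp [add_comm]

lemma defect_singleton (a : V) : defect F [a] = 0 := by simp [defect, jumps]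

lemma defect_nil : defect F [] = 0 := by simp [defect, jumps]

lemma defect_split (L : List V) (a : V) (R : List V) :
    defect F (L ++ a :: R) = defect F (L ++ [a]) + defect F (a :: R) := by
  induction L with
  | nil => simp [defect_singleton]
  | cons b L ih =>
    cases L with
    | nil => simp [defect_cons_cons, defect_singleton]
    | cons c L =>
      simp only [List.cons_append, defect_cons_cons] at ih ⊢
      omega

lemma defect_append_le (L R : List V) : defect F (L ++ R) ≤ defect F L + defect F R + 1 := by
  induction L with
  | nil => simp [defect_nil]
  | cons b L ih =>
    cases L with
    | nil =>
      cases R with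
      | nil => simp [defect_nil]
      | cons c R =>
        simp only [List.cons_append, List.nil_append, defect_cons_cons, defect_singleton]
        split_ifs <;> omega
    | cons c L =>
      simp only [List.cons_append, defect_cons_cons] at ih ⊢
      omega

lemma defect_add_le (L R : List V) : defect F L + defect F R ≤ defect F (L ++ R) := by
  induction L with
  | nil => simp [defect_nil]
  | cons b L ih =>
    cases L with
    | nil =>
      cases R with
      | nil => simp [defect_nil]
      | cons c R =>
        simp only [List.cons_append, List.nil_append, defect_cons_cons, defect_singleton]
        omega
    | cons c L =>
      simp only [List.cons_append, defect_cons_cons] at ih ⊢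
      omega

lemma defect_reverse (p : List V) : defect F p.reverse = defect F p := by
  induction p with
  | nil => rfl
  | cons a p ih =>
    cases p with
    | nil => rfl
    | cons b l =>
      rw [List.reverse_cons, List.reverse_cons, List.append_assoc, List.singleton_append,
        defect_split, defect_cons_cons, defect_cons_cons, defect_singleton,
        ← List.reverse_cons, ih]
      simp only [F.adj_comm a b]
      omega

lemma defect_eq_zero {p : List V} (h : p.IsChain F.Adj) : defect F p = 0 := by
  induction p with
  | nil => rfl
  | cons a p ih =>
    cases p with
    | nil => rfl
    | cons b l =>
      rw [List.isChain_cons_cons] at h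
      rw [defect_cons_cons, ih h.2, if_pos h.1]

lemma adj_of_notMem_jumps {p A B : List V} {u w : V} (hp : p = A ++ u :: w :: B)
    (h : w ∉ jumps F p) : F.Adj u w := by
  subst hp
  induction A with
  | nil =>
    rw [List.nil_append, jumps] at h
    by_contra hn
    simp [hn] at h
  | cons a A ih =>
    apply ih
    intro h'
    apply h
    cases A with
    | nil =>
      simp only [List.cons_append, List.nil_append] at h' ⊢
      rw [jumps]
      split_ifs
      · exact h'
      · exact List.mem_cons_of_mem _ h'
    | cons c A =>
      simp only [List.cons_append] at h' ⊢
      rw [jumps]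
      split_ifs
      · exact h'
      · exact List.mem_cons_of_mem _ h'

end Lists

section Predecessors

variable {V : Type*}

lemma exists_pred {p : List V} {w : V} (hw : w ∈ p) (hne : p.head? ≠ some w) :
    ∃ A u B, p = A ++ u :: w :: B := by
  obtain ⟨L, R, rfl⟩ := List.append_of_mem hw
  rcases List.eq_nil_or_concat L with rfl | ⟨A, u, rfl⟩
  · simp at hne
  · exact ⟨A, u, R, by simp⟩

/-- Taking predecessors along a duplicate-free list is injective. -/
lemma exists_pred_finset [DecidableEq V] {p : List V} (hp : p.Nodup) (W : Finset V)
    (P : V → V → Prop) (hW : ∀ w ∈ W, ∃ A u B, p = A ++ u :: w :: B ∧ P u w) :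
    ∃ S : Finset V, S.card = W.card ∧
      ∀ u ∈ S, ∃ w ∈ W, P u w ∧ ∃ A B, p = A ++ u :: w :: B := by
  choose! A f B hf using hW
  refine ⟨W.image f, Finset.card_image_of_injOn ?_, ?_⟩
  · intro w hw w' hw' h
    have h1 := (hf w hw).1
    have h2 := (hf w' hw').1
    rw [← h] at h2
    have hn := hp
    rw [h1, List.nodup_append] at hn
    have hn' := hp
    rw [h2, List.nodup_append] at hn'
    have h3 := (List.append_cons_inj_of_notMem
      (fun hx => hn'.2.2 _ hx _ (List.mem_cons_self) rfl)
      (fun hz => (List.nodup_cons.1 hn'.2.1).1 hz)).1 (h2.symm.trans h1)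
    simpa using congrArg List.head? h3.2.2.symm
  · intro u hu
    obtain ⟨w, hw, rfl⟩ := Finset.mem_image.1 hu
    exact ⟨w, hw, (hf w hw).2, A w, B w, (hf w hw).1⟩

lemma exists_split_card [DecidableEq V] {p : List V} (hp : p.Nodup) (I : Finset V)
    (hI : I ⊆ p.toFinset) {q : ℕ} (hq : q ≤ I.card) :
    ∃ L R, p = L ++ R ∧ (I ∩ L.toFinset).card = q := by
  have key : ∀ (p : List V) (q : ℕ), q ≤ (p.filter (· ∈ I)).length →
      ∃ L R, p = L ++ R ∧ (L.filter (· ∈ I)).length = q := by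
    intro p
    induction p with
    | nil => exact fun q hq => ⟨[], [], rfl, by simpa [eq_comm] using hq⟩
    | cons a p ih =>
      intro q hq
      rcases q.eq_zero_or_pos with rfl | hpos
      · exact ⟨[], a :: p, rfl, rfl⟩
      by_cases ha : a ∈ I
      · obtain ⟨L, R, rfl, hL⟩ := ih (q - 1) (by simp [ha] at hq ⊢; omega)
        exact ⟨a :: L, R, rfl, by simp [ha] at hL ⊢; omega⟩
      · obtain ⟨L, R, rfl, hL⟩ := ih q (by simpa [ha] using hq)
        exact ⟨a :: L, R, rfl, by simpa [ha] using hL⟩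
  have card_eq : ∀ L : List V, L.Nodup → (I ∩ L.toFinset).card = (L.filter (· ∈ I)).length := by
    intro L hL
    rw [← List.toFinset_card_of_nodup (hL.filter _)]
    congr 1
    ext x
    simp [and_comm]
  obtain ⟨L, R, rfl, hL⟩ := key p q (by
    rw [← card_eq p hp, Finset.inter_eq_left.2 hI]; exact hq)
  exact ⟨L, R, rfl, by rw [card_eq L hp.of_append_left, hL]⟩

end Predecessors

/-! ### Covering paths and rotations -/

section Paths

variable {V : Type*} (F H : SimpleGraph V)

/-- The vertex sequence `p` is a path of `F ∪ H` whose vertex set is a union of components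
of `F`. -/
structure IsClosedPath (p : List V) : Prop where
  nodup : p.Nodup
  chain : p.IsChain (F ⊔ H).Adj
  closed : ∀ v ∈ p, ∀ w, F.Adj v w → w ∈ p

variable {F H}

lemma IsClosedPath.reverse {p : List V} (hp : IsClosedPath F H p) : IsClosedPath F H p.reverse where
  nodup := List.nodup_reverse.2 hp.nodup
  chain := by
    rw [List.isChain_reverse]
    exact hp.chain.imp fun _ _ h => h.symm
  closed := by simpa using hp.closed

/-- Pósa rotation: if the first vertex of a path is joined to the inner vertex `w`, the part of the
path before `w` can be reversed. The predecessor of `w` becomes the first vertex. -/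
lemma IsClosedPath.rotate [DecidableRel F.Adj] {L R : List V} {s w : V}
    (hp : IsClosedPath F H (L ++ w :: R)) (hs : L.head? = some s) (h : H.Adj s w) :
    IsClosedPath F H (L.reverse ++ w :: R) ∧
      defect F (L.reverse ++ w :: R) ≤ defect F (L ++ w :: R) + 1 := by
  have hperm : (L.reverse ++ w :: R).Perm (L ++ w :: R) := (List.reverse_perm L).append_right _
  refine ⟨⟨hperm.nodup_iff.2 hp.nodup, ?_, ?_⟩, ?_⟩
  · have hc := List.isChain_append.1 hp.chain
    refine List.isChain_append.2 ⟨?_, hc.2.1, ?_⟩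
    · rw [List.isChain_reverse]
      exact hc.1.imp fun _ _ h => h.symm
    · intro x hx y hy
      rw [List.getLast?_reverse, hs] at hx
      simp only [Option.mem_def, Option.some.injEq, List.head?_cons] at hx hy
      subst hx hy
      exact Or.inr h
  · intro v hv x hx
    exact hperm.mem_iff.2 (hp.closed v (hperm.mem_iff.1 hv) x hx)
  · have h1 := defect_append_le F L.reverse (w :: R)
    have h2 := defect_add_le F L (w :: R)
    rw [defect_reverse] at h1
    omega

/-- Rotating through a neighbour of the first vertex that the path enters by an `F`-edge. -/
lemma IsClosedPath.exists_rotation [DecidableRel F.Adj] {p : List V}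
    (hp : IsClosedPath F H p) {s w : V} (hs : p.head? = some s) (h : H.Adj s w) (hw : w ∈ p)
    (hj : w ∉ jumps F p) :
    ∃ u p', F.Adj u w ∧ p'.Perm p ∧ IsClosedPath F H p' ∧ defect F p' ≤ defect F p + 1 ∧
      p'.head? = some u ∧ p'.getLast? = p.getLast? ∧ ∃ B C, p = B ++ u :: w :: C := by
  obtain ⟨B, u, C, rfl⟩ := exists_pred hw (by rw [hs]; rintro ⟨⟩; exact h.ne rfl)
  have e : B ++ u :: w :: C = (B ++ [u]) ++ w :: C := by simp
  have hs' : (B ++ [u]).head? = some s := by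
    rw [← hs]
    cases B <;> rfl
  have h1 := IsClosedPath.rotate (L := B ++ [u]) (R := C) (by rwa [← e]) hs' h
  refine ⟨u, (B ++ [u]).reverse ++ w :: C, adj_of_notMem_jumps F rfl hj, ?_, h1.1, ?_, ?_, ?_,
    B, C, rfl⟩
  · rw [e]
    exact (List.reverse_perm _).append_right _
  · rw [e]
    exact h1.2
  · simp
  · simp [List.getLast?_append, List.getLast?_cons]

/-- A path whose first vertex has a neighbour off the path absorbs the `F`-component of that
neighbour, given a spanning path `c` of this component. -/
lemma IsClosedPath.extend [DecidableRel F.Adj] {p c : List V} {s y : V}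
    (hp : IsClosedPath F H p) (hs : p.head? = some s) (h : H.Adj s y) (hy : y ∉ p)
    (hcn : c.Nodup) (hcc : c.IsChain F.Adj) (hcy : c.head? = some y)
    (hcm : ∀ v, v ∈ c ↔ F.Reachable y v) :
    IsClosedPath F H (c.reverse ++ p) ∧ defect F (c.reverse ++ p) ≤ defect F p + 1 := by
  have hreach : ∀ v w, F.Reachable v w → v ∈ p → w ∈ p := by
    rintro v w ⟨W⟩ hv
    induction W with
    | nil => exact hv
    | cons h _ ih => exact ih (hp.closed _ hv _ h)
  refine ⟨⟨?_, ?_, ?_⟩, ?_⟩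
  · refine List.nodup_append.2 ⟨List.nodup_reverse.2 hcn, hp.nodup, ?_⟩
    rintro a ha b hb rfl
    exact hy (hreach a y ((hcm a).1 (List.mem_reverse.1 ha)).symm hb)
  · refine List.isChain_append.2 ⟨?_, hp.chain, ?_⟩
    · rw [List.isChain_reverse]
      exact hcc.imp fun _ _ h => Or.inl h.symm
    · intro a ha b hb
      rw [List.getLast?_reverse, hcy] at ha
      rw [hs] at hb
      simp only [Option.mem_def, Option.some.injEq] at ha hb
      subst ha hb
      exact Or.inr h.symm
  · intro v hv w hw
    rw [List.mem_append, List.mem_reverse, hcm] at hv ⊢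
    rcases hv with hv | hv
    · exact Or.inl (hv.trans hw.reachable)
    · exact Or.inr (hp.closed v hv w hw)
  · have h1 := defect_append_le F c.reverse p
    rw [defect_reverse, defect_eq_zero F hcc] at h1
    omega

/-- In a finite 2-regular graph, each component has a spanning path that starts at a prescribed
vertex. -/
lemma exists_component_path [Fintype V] [DecidableRel F.Adj] (hF : F.IsRegularOfDegree 2)
    (y : V) : ∃ c : List V, c.Nodup ∧ c.IsChain F.Adj ∧ c.head? = some y ∧
      ∀ v, v ∈ c ↔ F.Reachable y v := by
  have hcyc : F.IsCycles := by
    intro v _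
    rw [← hF v, ← F.card_neighborSet_eq_degree, Set.ncard_eq_toFinset_card', Set.toFinset_card]
  have hn : (F.neighborSet y).Nonempty := by
    rw [← F.degree_pos_iff_nonempty, hF y]
    exact two_pos
  obtain ⟨w, hw, hverts⟩ := hcyc.exists_cycle_toSubgraph_verts_eq_connectedComponentSupp
    (c := F.connectedComponentMk y) (v := y) rfl hn
  refine ⟨w.support.tail.reverse, List.nodup_reverse.2 hw.support_nodup, ?_, ?_, ?_⟩
  · rw [List.isChain_reverse]
    exact w.isChain_adj_support.tail.imp fun _ _ h => h.symm
  · rw [List.head?_reverse]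
    cases w with
    | nil => simp at hw
    | cons h w => 
      rw [SimpleGraph.Walk.support_cons, List.tail_cons, List.getLast?_eq_some_getLast (by simp)]
      simp
  · intro v
    have h1 : v ∈ w.support ↔ F.Reachable y v := by
      have := Set.ext_iff.1 hverts v
      rw [SimpleGraph.Walk.mem_verts_toSubgraph] at this
      rw [this, SimpleGraph.ConnectedComponent.mem_supp_iff, SimpleGraph.ConnectedComponent.eq]
      exact ⟨fun h => h.symm, fun h => h.symm⟩
    rw [List.mem_reverse, ← h1]
    cases w with
    | nil => simp at hw
    | cons h w => 
      simp only [SimpleGraph.Walk.support_cons, List.tail_cons, List.mem_cons]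
      exact ⟨Or.inr, fun h => h.elim (fun h => h ▸ w.end_mem_support) id⟩

end Paths

section HamiltonCycle

variable {V : Type*} {F H : SimpleGraph V}

lemma exists_walk_of_isChain [DecidableEq V] [Fintype V] [DecidableRel F.Adj] [DecidableRel H.Adj]
    (p : List V) (s t : V) (hp : p.IsChain (F ⊔ H).Adj) (hs : p.head? = some s)
    (ht : p.getLast? = some t) :
    ∃ w : (F ⊔ H).Walk s t, w.support = p ∧
      (w.edges.toFinset \ F.edgeFinset).card ≤ defect F p := by
  induction p generalizing s with
  | nil => simp at hs
  | cons a p ih =>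
    obtain rfl : a = s := by simpa using hs
    cases p with
    | nil =>
      obtain rfl : a = t := by simpa using ht
      exact ⟨.nil, by simp⟩
    | cons b l =>
      rw [List.isChain_cons_cons] at hp
      obtain ⟨w, hw, hd⟩ := ih b hp.2 rfl (by simpa using ht)
      refine ⟨.cons hp.1 w, by simp [hw], ?_⟩
      rw [SimpleGraph.Walk.edges_cons, List.toFinset_cons, defect_cons_cons]
      split_ifs with h
      · rw [Finset.insert_sdiff_of_mem _ (by simpa using h)]
        omega
      · rw [Finset.insert_sdiff_of_notMem _ (by simpa using h)]
        have := Finset.card_insert_le s(a, b) (w.edges.toFinset \ F.edgeFinset)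
        omega

/-- A spanning path whose ends are joined by an edge closes to a Hamilton cycle. It has as many
edges as the 2-factor `F`, so that its symmetric difference with `F` is determined by the number of
its edges outside `F`. -/
lemma exists_hamiltonianCycle [DecidableEq V] [Fintype V] [DecidableRel F.Adj] [DecidableRel H.Adj]
    (hF : F.IsRegularOfDegree 2) {p : List V} {s t : V} (hp : IsClosedPath F H p)
    (hs : p.head? = some s) (ht : p.getLast? = some t) (hts : H.Adj t s) (hall : ∀ v, v ∈ p) :
    ∃ (v : V) (C : (F ⊔ H).Walk v v), C.IsHamiltonianCycle ∧
      (symmDiff C.edges.toFinset F.edgeFinset).card ≤ 2 * (defect F p + 1) := by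
  obtain ⟨w, hw, hd⟩ := exists_walk_of_isChain p s t hp.chain hs ht
  have hwp : w.IsPath := by rw [SimpleGraph.Walk.isPath_def, hw]; exact hp.nodup
  have hlen : p.length = Fintype.card V := by
    rw [← List.toFinset_card_of_nodup hp.nodup, ← Finset.card_univ]
    congr 1
    ext v
    simp [hall v]
  have hcard : 3 ≤ Fintype.card V := by
    have h1 := F.degree_lt_card_verts s
    rw [hF s] at h1
    omega
  have hwl : w.length + 1 = Fintype.card V := by
    rw [← hlen, ← hw, SimpleGraph.Walk.length_support]
  have hnot : s(t, s) ∉ w.edges := by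
    intro hmem
    have := hwp.length_eq_one_of_mem_edges (Sym2.eq_swap ▸ hmem)
    omega
  let C : (F ⊔ H).Walk t t := .cons (Or.inr hts) w
  have hC : C.IsCycle := (SimpleGraph.Walk.cons_isCycle_iff w _).2 ⟨hwp, hnot⟩
  refine ⟨t, C, ?_, ?_⟩
  · rw [SimpleGraph.Walk.isHamiltonianCycle_iff_isCycle_and_support_count_tail_eq_one]
    refine ⟨hC, fun v => ?_⟩
    simp only [C, SimpleGraph.Walk.support_cons, List.tail_cons, hw]
    exact List.count_eq_one_of_mem hp.nodup (hall v)
  · have hCcard : C.edges.toFinset.card = Fintype.card V := by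
      rw [List.toFinset_card_of_nodup hC.edges_nodup, SimpleGraph.Walk.length_edges]
      simpa [C] using hwl
    have hFcard : F.edgeFinset.card = Fintype.card V := by
      have h1 := F.sum_degrees_eq_twice_card_edges
      rw [Finset.sum_congr rfl (fun v _ => hF v), Finset.sum_const, Finset.card_univ,
        smul_eq_mul] at h1
      omega
    have h1 : (C.edges.toFinset \ F.edgeFinset).card ≤ defect F p + 1 := by
      have hCe : C.edges = s(t, s) :: w.edges := SimpleGraph.Walk.edges_cons _ _
      rw [hCe, List.toFinset_cons]
      have hsub : insert s(t, s) w.edges.toFinset \ F.edgeFinset ⊆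
          insert s(t, s) (w.edges.toFinset \ F.edgeFinset) := by
        intro x
        simp only [Finset.mem_sdiff, Finset.mem_insert]
        tauto
      exact (Finset.card_le_card hsub).trans ((Finset.card_insert_le _ _).trans (by omega))
    have h2 := Finset.card_sdiff_add_card_inter C.edges.toFinset F.edgeFinset
    have h3 := Finset.card_sdiff_add_card_inter F.edgeFinset C.edges.toFinset
    rw [Finset.inter_comm] at h3
    have h4 : (symmDiff C.edges.toFinset F.edgeFinset).card ≤
        (C.edges.toFinset \ F.edgeFinset).card + (F.edgeFinset \ C.edges.toFinset).card :=
      Finset.card_union_le _ _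
    omega

end HamiltonCycle

/-! ### Rotations in a system of clusters -/

lemma card_interedges_eq_sum {V : Type*} (H : SimpleGraph V) [DecidableRel H.Adj] (S T : Finset V) :
    (H.interedges S T).card = ∑ u ∈ S, (T.filter fun w => H.Adj u w).card := by
  rw [SimpleGraph.interedges, Rel.interedges, Finset.card_filter, Finset.sum_product]
  simp only [Finset.card_filter]

section Core

variable {V ι : Type*} [Fintype V] [DecidableEq V]

/-- The `H`-neighbours of `v` in the cluster `A (σ a)` all of whose `F`-neighbours lie in the
cluster `A a`. When `v` is the first vertex of a path, rotating through such a neighbour gives a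
path whose first vertex lies in `A a`, unless the path enters the neighbour through a non-`F`
step. -/
def typicalNeighbors (F H : SimpleGraph V) [DecidableRel F.Adj] [DecidableRel H.Adj]
    (A : ι → Finset V) (σ : ι → ι) (a : ι) (v : V) : Finset V :=
  (A (σ a)).filter fun w => H.Adj v w ∧ ∀ u, F.Adj w u → u ∈ A a

/-- The combinatorial content of the regularity hypotheses. The map `σ` pairs up the clusters `A i`;
`Q i j` stands for weak regularity of `(A i, A j)`; `N` bounds the number of non-`F` steps of the
paths under consideration; and `q` is the size from which on sets are seen by regularity. Of
`2 N + 2 q + 2` typical neighbours, `2 q` remain when one vertex and those next to a non-`F` step of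
a path, in either direction, are discarded. -/
structure IsClusterSystem (F H : SimpleGraph V) [DecidableRel F.Adj] [DecidableRel H.Adj]
    (A : ι → Finset V) (σ : ι → ι) (Q : ι → ι → Prop) (N q : ℕ) : Prop where
  invol : ∀ i, σ (σ i) = i
  q_pos : 0 < q
  typical : ∀ v, ∃ a, 2 * N + 2 * q + 2 ≤ (typicalNeighbors F H A σ a v).card
  typical_mem : ∀ a, ∀ v ∈ A a, 2 * N + 2 * q + 2 ≤ (typicalNeighbors F H A σ a v).card
  many_edges : ∀ a j, Q a j → ∀ S ⊆ A a, ∀ T ⊆ A j, q ≤ S.card → q ≤ T.card →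
    N * S.card < (H.interedges S T).card
  exists_edge : ∀ a, ∀ S ⊆ A a, ∀ T ⊆ A (σ a), q ≤ S.card → q ≤ T.card →
    ∃ x ∈ S, ∃ y ∈ T, H.Adj x y
  common_twisted : ∀ a b, ∃ j, Q a (σ j) ∧ Q b j
  common : ∀ a b, ∃ j, Q a j ∧ Q b j
  inner : ∀ j, q ≤ ((A j).filter fun w => ∀ u, F.Adj w u → u ∈ A (σ j)).card

variable {F H : SimpleGraph V} [DecidableRel F.Adj] [DecidableRel H.Adj]
  {A : ι → Finset V} {σ : ι → ι} {Q : ι → ι → Prop} {N q : ℕ}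

lemma mem_typicalNeighbors {a : ι} {v w : V} : w ∈ typicalNeighbors F H A σ a v ↔
    w ∈ A (σ a) ∧ H.Adj v w ∧ ∀ u, F.Adj w u → u ∈ A a := by
  simp [typicalNeighbors]

/-- The first vertices of the paths with the vertex set of `p₀` and with at most `M` non-`F` steps
have no `H`-neighbours outside `p₀`. -/
def IsStuck (F H : SimpleGraph V) [DecidableRel F.Adj] (p₀ : List V) (M : ℕ) : Prop :=
  ∀ p : List V, p.Perm p₀ → IsClosedPath F H p → defect F p ≤ M →
    ∀ s y, p.head? = some s → H.Adj s y → y ∈ p₀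

/-- One rotation reaches `q` first vertices in the cluster attached to the first vertex. -/
lemma exists_many_rotations {p₀ : List V} {M : ℕ}
    (hM : IsStuck F H p₀ M) (hMN : M ≤ N) {a : ι} {s : V}
    (ha : 2 * N + 2 * q + 2 ≤ (typicalNeighbors F H A σ a s).card)
    {p : List V} (hpp : p.Perm p₀) (hp : IsClosedPath F H p) (hd : defect F p ≤ M)
    (hs : p.head? = some s) :
    ∃ S ⊆ A a, q ≤ S.card ∧ ∀ u ∈ S, ∃ p' : List V, p'.Perm p ∧ IsClosedPath F H p' ∧
      defect F p' ≤ defect F p + 1 ∧ p'.head? = some u ∧ p'.getLast? = p.getLast? := by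
  set W := typicalNeighbors F H A σ a s \ (jumps F p).toFinset with hW
  have hWc : q ≤ W.card := by
    have h1 := Finset.le_card_sdiff (jumps F p).toFinset (typicalNeighbors F H A σ a s)
    have h2 : (jumps F p).toFinset.card ≤ defect F p := List.toFinset_card_le _
    rw [← hW] at h1
    omega
  have hW' : ∀ w ∈ W, H.Adj s w ∧ (∀ u, F.Adj w u → u ∈ A a) ∧ w ∉ jumps F p ∧ w ∈ p := by
    intro w hw
    rw [hW, Finset.mem_sdiff, mem_typicalNeighbors, List.mem_toFinset] at hw
    exact ⟨hw.1.2.1, hw.1.2.2, hw.2, hpp.mem_iff.2 (hM p hpp hp hd s w hs hw.1.2.1)⟩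
  obtain ⟨S, hSc, hS'⟩ := exists_pred_finset hp.nodup W
    (fun u w => F.Adj u w ∧ ∃ p' : List V, p'.Perm p ∧ IsClosedPath F H p' ∧
      defect F p' ≤ defect F p + 1 ∧ p'.head? = some u ∧ p'.getLast? = p.getLast?) (by
    intro w hw
    obtain ⟨h1, -, h3, h4⟩ := hW' w hw
    obtain ⟨u, p', huw, k1, k2, k3, k4, k5, B, C, hBC⟩ := hp.exists_rotation hs h1 h4 h3
    exact ⟨B, u, C, hBC, huw, p', k1, k2, k3, k4, k5⟩)
  refine ⟨S, ?_, by omega, ?_⟩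
  · intro u hu
    obtain ⟨w, hw, ⟨huw, -⟩, -⟩ := hS' u hu
    exact (hW' w hw).2.1 u huw.symm
  · intro u hu
    obtain ⟨w, -, ⟨-, h⟩, -⟩ := hS' u hu
    exact h

/-- Two rotations bring the first vertex into the partner of any cluster that is weakly regular
with the cluster attached to the first vertex. -/
lemma IsClusterSystem.rotate_twice (hS : IsClusterSystem F H A σ Q N q) {p₀ : List V} {M : ℕ}
    (hM : IsStuck F H p₀ M) (hMN : M ≤ N) {a j : ι} {s : V}
    (ha : 2 * N + 2 * q + 2 ≤ (typicalNeighbors F H A σ a s).card) (haj : Q a j)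
    {p : List V} (hpp : p.Perm p₀) (hp : IsClosedPath F H p) (hd : defect F p + 1 ≤ M)
    (hs : p.head? = some s) :
    ∃ u ∈ A (σ j), ∃ p' : List V, p'.Perm p ∧ IsClosedPath F H p' ∧
      defect F p' ≤ defect F p + 2 ∧ p'.head? = some u ∧ p'.getLast? = p.getLast? := by
  obtain ⟨S, hSA, hSq, hS'⟩ := exists_many_rotations hM hMN ha hpp hp (by omega) hs
  set T := (A j).filter fun w => ∀ u, F.Adj w u → u ∈ A (σ j) with hT
  have hlt := hS.many_edges a j haj S hSA T (Finset.filter_subset _ _) hSq (hS.inner j)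
  -- by pigeonhole some new first vertex has more neighbours in `T` than its path has non-`F` steps
  have hex : ∃ u ∈ S, N < (T.filter fun w => H.Adj u w).card := by
    by_contra! hcon
    have h1 := card_interedges_eq_sum H S T
    have h2 := Finset.sum_le_card_nsmul S _ N hcon
    rw [smul_eq_mul, mul_comm] at h2
    omega
  obtain ⟨u, hu, hNu⟩ := hex
  obtain ⟨p', k1, k2, k3, k4, k5⟩ := hS' u hu
  have hj : (jumps F p').toFinset.card ≤ defect F p' := List.toFinset_card_le _
  obtain ⟨w, hw, hwj⟩ := Finset.exists_mem_notMem_of_card_lt_card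
    (s := (jumps F p').toFinset) (t := T.filter fun w => H.Adj u w) (by omega)
  rw [Finset.mem_filter, hT, Finset.mem_filter] at hw
  have hwp : w ∈ p' := (k1.trans hpp).mem_iff.2
    (hM p' (k1.trans hpp) k2 (by omega) u w k4 hw.2)
  obtain ⟨x, p'', hxw, l1, l2, l3, l4, l5, -⟩ :=
    k2.exists_rotation k4 hw.2 hwp (by simpa using hwj)
  exact ⟨x, hw.1.2 x hxw.symm, p'', l1.trans k1, l2, by omega, l4, l5.trans k5⟩

/-- A path whose ends lie in partner clusters closes to a cycle after two rotations. The path is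
cut into `L ++ R` such that both parts contain many pivots for a first rotation. The neighbours `x`
of the last vertex are numerous in one part; pivots in the other part are used, as then it is known
in which direction the rotated path runs through the neighbourhood of `x`. An edge between the two
sets of candidates, given by super-regularity, yields the second rotation. -/
lemma IsClusterSystem.exists_cycle (hS : IsClusterSystem F H A σ Q N q) {p₀ : List V} {M : ℕ}
    (hM : IsStuck F H p₀ M) (hMN : M ≤ N) {a : ι} {s t : V} (hsa : s ∈ A a) (hta : t ∈ A (σ a))
    {p : List V} (hpp : p.Perm p₀) (hp : IsClosedPath F H p) (hd : defect F p ≤ M)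
    (hs : p.head? = some s) (ht : p.getLast? = some t) :
    ∃ p' x y, p'.Perm p ∧ IsClosedPath F H p' ∧ defect F p' ≤ defect F p + 2 ∧
      p'.head? = some x ∧ p'.getLast? = some y ∧ H.Adj y x := by
  have hj : (jumps F p).toFinset.card ≤ defect F p := List.toFinset_card_le _
  have hj' : (jumps F p.reverse).toFinset.card ≤ defect F p := by
    rw [← defect_reverse]
    exact List.toFinset_card_le _
  have hstuck : ∀ w, H.Adj s w → w ∈ p := fun w hw =>
    hpp.mem_iff.2 (hM p hpp hp hd s w hs hw)
  have hstuck' : ∀ w, H.Adj t w → w ∈ p := fun w hw =>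
    hpp.mem_iff.2 (hM p.reverse ((List.reverse_perm p).trans hpp) hp.reverse
      (by rwa [defect_reverse]) t w (by simpa using ht) hw)
  set I := typicalNeighbors F H A σ a s \ (jumps F p).toFinset with hI
  have hIm : ∀ w ∈ I, H.Adj s w ∧ (∀ u, F.Adj w u → u ∈ A a) ∧ w ∉ jumps F p := by
    intro w hw
    rw [hI, Finset.mem_sdiff, mem_typicalNeighbors, List.mem_toFinset] at hw
    exact ⟨hw.1.2.1, hw.1.2.2, hw.2⟩
  have hIc : 2 * q ≤ I.card := by
    have h1 := Finset.le_card_sdiff (jumps F p).toFinset (typicalNeighbors F H A σ a s)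
    have h2 := hS.typical_mem a s hsa
    rw [← hI] at h1
    omega
  set X := typicalNeighbors F H A σ (σ a) t \
    (insert s ((jumps F p).toFinset ∪ (jumps F p.reverse).toFinset)) with hX
  have hXm : ∀ w ∈ X, H.Adj t w ∧ (∀ u, F.Adj w u → u ∈ A (σ a)) ∧ w ≠ s ∧ w ∉ jumps F p ∧
      w ∉ jumps F p.reverse := by
    intro w hw
    rw [hX, Finset.mem_sdiff, mem_typicalNeighbors, Finset.mem_insert, Finset.mem_union,
      List.mem_toFinset, List.mem_toFinset] at hw
    tauto
  have hXc : 2 * q ≤ X.card := by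
    have h1 := Finset.le_card_sdiff (insert s ((jumps F p).toFinset ∪ (jumps F p.reverse).toFinset))
      (typicalNeighbors F H A σ (σ a) t)
    have h2 := hS.typical_mem (σ a) t hta
    rw [← hX] at h1
    have h3 := Finset.card_insert_le s ((jumps F p).toFinset ∪ (jumps F p.reverse).toFinset)
    have h4 := Finset.card_union_le (jumps F p).toFinset (jumps F p.reverse).toFinset
    omega
  obtain ⟨L, R, hLR, hIL⟩ := exists_split_card hp.nodup I
    (fun w hw => List.mem_toFinset.2 (hstuck w (hIm w hw).1)) (q := q) (by omega)
  have hsplit : ∀ Y : Finset V, (∀ w ∈ Y, w ∈ p) →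
      Y.card ≤ (Y ∩ L.toFinset).card + (Y ∩ R.toFinset).card := by
    intro Y hY
    refine le_trans (Finset.card_le_card ?_) (Finset.card_union_le _ _)
    intro w hw
    have := hY w hw
    rw [hLR, List.mem_append] at this
    simpa [hw] using this
  have hIR : q ≤ (I ∩ R.toFinset).card := by
    have := hsplit I (fun w hw => hstuck w (hIm w hw).1)
    omega
  have hXLR := hsplit X (fun w hw => hstuck' w (hXm w hw).1)
  have hq := hS.q_pos
  subst hLR
  have hLne : L ≠ [] := by
    rintro rfl
    simp at hIL
    omega
  have hLs : L.head? = some s := by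
    rw [← hs, List.head?_append_of_ne_nil _ hLne]
  have hRne : R ≠ [] := by
    rintro rfl
    simp at hIR
    omega
  have hRt : R.reverse.head? = some t := by
    rw [← ht, List.getLast?_append_of_ne_nil _ hRne, List.head?_reverse]
  rcases le_or_gt q (X ∩ R.toFinset).card with hXR | hXR
  · -- pivots in `L`, neighbours of `t` in `R`
    obtain ⟨S, hSc, hSm⟩ := exists_pred_finset hp.nodup.of_append_left (I ∩ L.toFinset)
      (fun u w => F.Adj u w) (by
      intro w hw
      rw [Finset.mem_inter, List.mem_toFinset] at hw
      obtain ⟨B, u, C, hBC⟩ := exists_pred hw.2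
        (by rw [hLs]; rintro ⟨⟩; exact (hIm _ hw.1).1.ne rfl)
      exact ⟨B, u, C, hBC, adj_of_notMem_jumps F (A := B) (B := C ++ R) (by simp [hBC])
        (hIm w hw.1).2.2⟩)
    obtain ⟨T, hTc, hTm⟩ := exists_pred_finset
      (List.nodup_reverse.2 hp.nodup.of_append_right) (X ∩ R.toFinset)
      (fun u w => F.Adj u w) (by
      intro w hw
      rw [Finset.mem_inter, List.mem_toFinset] at hw
      obtain ⟨B, u, C, hBC⟩ := exists_pred (List.mem_reverse.2 hw.2)
        (by rw [hRt]; rintro ⟨⟩; exact (hXm _ hw.1).1.ne rfl)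
      exact ⟨B, u, C, hBC, adj_of_notMem_jumps F (A := B) (B := C ++ L.reverse) (by simp [hBC])
        (hXm w hw.1).2.2.2.2⟩)
    obtain ⟨u, hu, w, hw, huw⟩ := hS.exists_edge a S
      (fun u hu => by
        obtain ⟨v, hv, huv, -⟩ := hSm u hu
        exact (hIm v (Finset.mem_inter.1 hv).1).2.1 u huv.symm) T
      (fun u hu => by
        obtain ⟨v, hv, huv, -⟩ := hTm u hu
        exact (hXm v (Finset.mem_inter.1 hv).1).2.1 u huv.symm) (by omega) (by omega)
    obtain ⟨v, hv, -, L₁, L₂, rfl⟩ := hSm u hu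
    obtain ⟨x, hx, -, R₁, R₂, hR⟩ := hTm w hw
    obtain rfl : R = R₂.reverse ++ x :: w :: R₁.reverse := by
      rw [← List.reverse_reverse R, hR]
      simp
    have e₁ : (L₁ ++ u :: v :: L₂) ++ (R₂.reverse ++ x :: w :: R₁.reverse) =
        (L₁ ++ [u]) ++ v :: (L₂ ++ (R₂.reverse ++ x :: w :: R₁.reverse)) := by simp
    have e₂ : (L₁ ++ [u]).reverse ++ v :: (L₂ ++ (R₂.reverse ++ x :: w :: R₁.reverse)) =
        ((L₁ ++ [u]).reverse ++ v :: (L₂ ++ R₂.reverse) ++ [x]) ++ w :: R₁.reverse := by simp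
    rw [e₁] at hp ht hd ⊢
    obtain ⟨hp₁, hd₁⟩ := hp.rotate (s := s)
      (by rw [← hLs]; cases L₁ <;> rfl) (hIm v (Finset.mem_inter.1 hv).1).1
    rw [e₂] at hp₁ hd₁
    obtain ⟨hp₂, hd₂⟩ := hp₁.rotate (s := u) (by simp) huw
    refine ⟨_, x, t, ?_, hp₂, by omega, by simp, ?_, (hXm x (Finset.mem_inter.1 hx).1).1⟩
    · refine ((List.reverse_perm _).append_right _).trans ?_
      rw [← e₂]
      exact (List.reverse_perm _).append_right _
    · rw [← ht]
      simp [List.getLast?_append, List.getLast?_cons]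
  · -- pivots in `R`, neighbours of `t` in `L`
    have hXL : q ≤ (X ∩ L.toFinset).card := by omega
    obtain ⟨S, hSc, hSm⟩ := exists_pred_finset hp.nodup (I ∩ R.toFinset)
      (fun u w => F.Adj u w ∧ ∃ R₁ R₂, R = R₁ ++ w :: R₂ ∧ (L ++ R₁).getLast? = some u) (by
      intro w hw
      rw [Finset.mem_inter, List.mem_toFinset] at hw
      obtain ⟨R₁, R₂, hR⟩ := List.append_of_mem hw.2
      have hne : L ++ R₁ ≠ [] := by simp [hLne]
      have e : L ++ R = (L ++ R₁).dropLast ++ (L ++ R₁).getLast hne :: w :: R₂ := by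
        have h1 := List.dropLast_append_getLast hne
        calc L ++ R = (L ++ R₁) ++ w :: R₂ := by simp [hR]
          _ = ((L ++ R₁).dropLast ++ [(L ++ R₁).getLast hne]) ++ w :: R₂ := by rw [h1]
          _ = _ := by simp
      exact ⟨_, _, _, e, adj_of_notMem_jumps F e (hIm w hw.1).2.2, R₁, R₂, hR,
        List.getLast?_eq_some_getLast hne⟩)
    obtain ⟨T, hTc, hTm⟩ := exists_pred_finset hp.nodup.of_append_left (X ∩ L.toFinset)
      (fun u w => F.Adj u w) (by
      intro w hw
      rw [Finset.mem_inter, List.mem_toFinset] at hw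
      obtain ⟨B, u, C, hBC⟩ := exists_pred hw.2
        (by rw [hLs]; rintro ⟨⟩; exact (hXm _ hw.1).2.2.1 rfl)
      exact ⟨B, u, C, hBC, adj_of_notMem_jumps F (A := B) (B := C ++ R) (by simp [hBC])
        (hXm w hw.1).2.2.2.1⟩)
    obtain ⟨u, hu, w, hw, huw⟩ := hS.exists_edge a S
      (fun u hu => by
        obtain ⟨v, hv, ⟨huv, -⟩, -⟩ := hSm u hu
        exact (hIm v (Finset.mem_inter.1 hv).1).2.1 u huv.symm) T
      (fun u hu => by
        obtain ⟨v, hv, huv, -⟩ := hTm u hu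
        exact (hXm v (Finset.mem_inter.1 hv).1).2.1 u huv.symm) (by omega) (by omega)
    obtain ⟨v, hv, ⟨-, R₁, R₂, rfl, hlast⟩, -⟩ := hSm u hu
    obtain ⟨x, hx, -, L₁, L₂, rfl⟩ := hTm w hw
    have e₁ : (L₁ ++ w :: x :: L₂) ++ (R₁ ++ v :: R₂) =
        (L₁ ++ w :: x :: L₂ ++ R₁) ++ v :: R₂ := by simp
    have e₂ : (L₁ ++ w :: x :: L₂ ++ R₁).reverse ++ v :: R₂ =
        (x :: (L₂ ++ R₁)).reverse ++ w :: (L₁.reverse ++ v :: R₂) := by simp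
    rw [e₁] at hp ht hd ⊢
    obtain ⟨hp₁, hd₁⟩ := hp.rotate (s := s)
      (by rw [← hLs]; cases L₁ <;> rfl) (hIm v (Finset.mem_inter.1 hv).1).1
    rw [e₂] at hp₁ hd₁
    obtain ⟨hp₂, hd₂⟩ := hp₁.rotate (s := u)
      (by
        rw [List.head?_reverse, ← hlast]
        simp [List.getLast?_append, List.getLast?_cons]) huw
    refine ⟨_, x, t, ?_, hp₂, by omega, by simp, ?_, (hXm x (Finset.mem_inter.1 hx).1).1⟩
    · refine ((List.reverse_perm _).append_right _).trans ?_
      rw [← e₂]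
      exact (List.reverse_perm _).append_right _
    · rw [← ht]
      simp [List.getLast?_append, List.getLast?_cons]

/-- A cluster system is connected: a nonempty set of vertices that `H` does not leave meets all
clusters in large sets, and hence, by weak regularity, contains them. -/
lemma IsClusterSystem.exists_leaving_edge (hS : IsClusterSystem F H A σ Q N q) (U : Finset V)
    {x₀ y₀ : V} (hx₀ : x₀ ∈ U) (hy₀ : y₀ ∉ U) : ∃ x ∈ U, ∃ y ∉ U, H.Adj x y := by
  by_contra! hcon
  have half : ∀ U : Finset V, (∀ x ∈ U, ∀ y ∉ U, ¬ H.Adj x y) → ∀ a, ∀ v ∈ A a, v ∈ U →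
      q ≤ (A a ∩ U).card := by
    intro U hU a
    have step : ∀ b, ∀ v ∈ A b, v ∈ U → 2 * N + 2 * q + 2 ≤ (A (σ b) ∩ U).card := by
      intro b v hv hvU
      refine (hS.typical_mem b v hv).trans (Finset.card_le_card fun w hw => ?_)
      rw [mem_typicalNeighbors] at hw
      refine Finset.mem_inter.2 ⟨hw.1, ?_⟩
      by_contra hwU
      exact hU v hvU w hwU hw.2.1
    intro v hv hvU
    have h1 := step a v hv hvU
    obtain ⟨w, hw⟩ := Finset.card_pos.1 (show 0 < (A (σ a) ∩ U).card by omega)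
    rw [Finset.mem_inter] at hw
    have h2 := step (σ a) w hw.1 hw.2
    rw [hS.invol] at h2
    omega
  have hconc : ∀ x ∈ Uᶜ, ∀ y ∉ Uᶜ, ¬ H.Adj x y := by
    intro x hx y hy h
    rw [Finset.mem_compl] at hx hy
    exact hcon y (not_not.1 hy) x hx h.symm
  have spread : ∀ U : Finset V, (∀ x ∈ U, ∀ y ∉ U, ¬ H.Adj x y) →
      (∀ x ∈ Uᶜ, ∀ y ∉ Uᶜ, ¬ H.Adj x y) → ∀ a j, Q a j → ∀ v ∈ A a, v ∈ U → A j ⊆ U := by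
    intro U hU hUc a j haj v hv hvU w hw
    by_contra hwU
    have h1 := half U hU a v hv hvU
    have h2 := half Uᶜ hUc j w hw (Finset.mem_compl.2 hwU)
    have h3 := hS.many_edges a j haj _ Finset.inter_subset_left _ Finset.inter_subset_left h1 h2
    obtain ⟨e, he⟩ := Finset.card_pos.1 (lt_of_le_of_lt (Nat.zero_le _) h3)
    rw [SimpleGraph.interedges, Rel.mem_interedges_iff, Finset.mem_inter, Finset.mem_inter,
      Finset.mem_compl] at he
    exact hU _ he.1.2 _ he.2.1.2 he.2.2
  have meets : ∀ U : Finset V, (∀ x ∈ U, ∀ y ∉ U, ¬ H.Adj x y) → ∀ x ∈ U,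
      ∃ a, ∃ v ∈ A a, v ∈ U := by
    intro U hU x hx
    obtain ⟨a, ha⟩ := hS.typical x
    obtain ⟨w, hw⟩ := Finset.card_pos.1 (show 0 < (typicalNeighbors F H A σ a x).card by omega)
    rw [mem_typicalNeighbors] at hw
    refine ⟨σ a, w, hw.1, ?_⟩
    by_contra hwU
    exact hU x hx w hwU hw.2.1
  obtain ⟨a, v, hv, hvU⟩ := meets U hcon x₀ hx₀
  obtain ⟨b, w, hw, hwU⟩ := meets Uᶜ hconc y₀ (Finset.mem_compl.2 hy₀)
  obtain ⟨j, haj, hbj⟩ := hS.common a b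
  have h1 := spread U hcon hconc a j haj v hv hvU
  have h2 := spread Uᶜ hconc (by simpa using hcon) b j hbj w hw hwU
  obtain ⟨z, hz⟩ := Finset.card_pos.1
    (lt_of_lt_of_le hS.q_pos ((hS.inner j).trans (Finset.card_filter_le _ _)))
  exact Finset.mem_compl.1 (h2 hz) (h1 hz)

end Core

/-! ### Absorbing all components -/

section Absorbing

variable {V ι : Type*} {F H : SimpleGraph V}

/-- The number of components of `F` met by the vertex sequence `p`. -/
noncomputable def componentCount (F : SimpleGraph V) (p : List V) : ℕ :=
  (F.connectedComponentMk '' {v | v ∈ p}).ncard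

lemma componentCount_le [Finite V] (p : List V) :
    componentCount F p ≤ Nat.card F.ConnectedComponent := by
  rw [← Set.ncard_univ]
  exact Set.ncard_le_ncard (Set.subset_univ _)

lemma componentCount_pos [Finite V] {p : List V} (hp : p ≠ []) : 0 < componentCount F p := by
  obtain ⟨v, hv⟩ := List.exists_mem_of_ne_nil p hp
  exact (Set.ncard_pos (Set.toFinite _)).2 ⟨_, v, hv, rfl⟩

lemma componentCount_congr {p p' : List V} (h : p'.Perm p) :
    componentCount F p' = componentCount F p := by
  simp only [componentCount, h.mem_iff]

variable [Fintype V] [DecidableRel F.Adj]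

/-- If the first vertex of `p` has an `H`-neighbour off `p`, a longer path meeting more components
exists, at the cost of one non-`F` step. -/
lemma IsClosedPath.exists_longer (hF : F.IsRegularOfDegree 2) {p : List V} {s y : V}
    (hp : IsClosedPath F H p) (hs : p.head? = some s) (h : H.Adj s y) (hy : y ∉ p) :
    ∃ p', IsClosedPath F H p' ∧ p.length < p'.length ∧ defect F p' ≤ defect F p + 1 ∧
      componentCount F p + 1 ≤ componentCount F p' := by
  obtain ⟨c, hcn, hcc, hcy, hcm⟩ := exists_component_path hF y
  obtain ⟨h1, h2⟩ := hp.extend hs h hy hcn hcc hcy hcm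
  have hyc : y ∈ c := (hcm y).2 (SimpleGraph.Reachable.refl y)
  refine ⟨_, h1, ?_, h2, ?_⟩
  · have := List.length_pos_of_mem hyc
    simp
    omega
  · have hnot : F.connectedComponentMk y ∉ F.connectedComponentMk '' {v | v ∈ p} := by
      rintro ⟨v, hv, hvy⟩
      refine (List.nodup_append.1 h1.nodup).2.2 v ?_ v hv rfl
      exact List.mem_reverse.2 ((hcm v).2 (SimpleGraph.ConnectedComponent.exact hvy.symm))
    rw [componentCount, ← Set.ncard_insert_of_notMem hnot (Set.toFinite _)]
    refine Set.ncard_le_ncard (Set.insert_subset ⟨y, by simp [hyc], rfl⟩ ?_) (Set.toFinite _)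
    exact Set.image_mono fun v hv => List.mem_append_right _ hv

variable [DecidableEq V] [DecidableRel H.Adj] {A : ι → Finset V} {σ : ι → ι} {Q : ι → ι → Prop}
  {N q : ℕ}

/-- Either a path closes to a Hamilton cycle, or it can be made longer. Each absorbed component is
charged with eight non-`F` steps: at most six for the rotations, one for closing up to a cycle, and
one for leaving it. -/
lemma IsClusterSystem.hamiltonian_or_longer (hS : IsClusterSystem F H A σ Q N q)
    (hF : F.IsRegularOfDegree 2) (hN : 8 * Nat.card F.ConnectedComponent ≤ N) {p : List V}
    (hp : IsClosedPath F H p) (hne : p ≠ []) (hd : defect F p + 8 ≤ 8 * componentCount F p) :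
    (∃ (v : V) (C : (F ⊔ H).Walk v v), C.IsHamiltonianCycle ∧
      (symmDiff C.edges.toFinset F.edgeFinset).card ≤ 16 * Nat.card F.ConnectedComponent) ∨
    ∃ p', IsClosedPath F H p' ∧ p.length < p'.length ∧
      defect F p' + 8 ≤ 8 * componentCount F p' := by
  refine or_iff_not_imp_right.2 fun hmax => ?_
  have hcc := componentCount_le (F := F) p
  have absorb : ∀ p' : List V, p'.Perm p → IsClosedPath F H p' → defect F p' ≤ defect F p + 7 →
      ∀ s y, p'.head? = some s → H.Adj s y → y ∈ p := by
    intro p' hpp hp' hd' s y hs hsy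
    by_contra hy
    obtain ⟨p'', h1, h2, h3, h4⟩ := hp'.exists_longer hF hs hsy (fun h => hy (hpp.mem_iff.1 h))
    rw [hpp.length_eq] at h2
    rw [componentCount_congr hpp] at h4
    exact hmax ⟨p'', h1, h2, by omega⟩
  have hM : IsStuck F H p (defect F p + 6) := fun p' h1 h2 h3 => absorb p' h1 h2 (by omega)
  obtain ⟨s, hs⟩ : ∃ s, p.head? = some s := ⟨_, List.head?_eq_some_head hne⟩
  obtain ⟨t, ht⟩ : ∃ t, p.getLast? = some t := ⟨_, List.getLast?_eq_some_getLast hne⟩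
  obtain ⟨a, ha⟩ := hS.typical s
  obtain ⟨b, hb⟩ := hS.typical t
  obtain ⟨j, haj, hbj⟩ := hS.common_twisted a b
  obtain ⟨u, hu, p₁, k1, k2, k3, k4, k5⟩ :=
    hS.rotate_twice hM (by omega) ha haj (List.Perm.refl p) hp (by omega) hs
  have hrev := List.reverse_perm p₁
  obtain ⟨v, hv, p₂, l1, l2, l3, l4, l5⟩ :=
    hS.rotate_twice (s := t) hM (by omega) hb hbj (hrev.trans k1) k2.reverse
      (by rw [defect_reverse]; omega) (by rw [List.head?_reverse, k5, ht])
  rw [defect_reverse] at l3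
  rw [List.getLast?_reverse, k4] at l5
  obtain ⟨p₃, x, y, m1, m2, m3, m4, m5, m6⟩ :=
    hS.exists_cycle hM (by omega) hv hu ((l1.trans hrev).trans k1) l2 (by omega) l4 l5
  have hperm : p₃.Perm p := m1.trans ((l1.trans hrev).trans k1)
  have hall : ∀ v, v ∈ p := by
    by_contra! hout
    obtain ⟨z, hz⟩ := hout
    obtain ⟨x', hx', y', hy', hxy⟩ := hS.exists_leaving_edge p.toFinset (x₀ := s) (y₀ := z)
      (by simpa using List.mem_of_mem_head? hs) (by simpa using hz)
    -- open the cycle at `x'`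
    obtain ⟨B, C, rfl⟩ := List.append_of_mem (hperm.mem_iff.2 (List.mem_toFinset.1 hx'))
    have hrot : ((x' :: C) ++ B).Perm (B ++ x' :: C) := List.perm_append_comm
    have hc := List.isChain_append.1 m2.chain
    refine hy' (List.mem_toFinset.2 (absorb ((x' :: C) ++ B) (hrot.trans hperm) ⟨?_, ?_, ?_⟩ ?_
      x' y' rfl hxy))
    · exact hrot.nodup_iff.2 m2.nodup
    · refine List.isChain_append.2 ⟨hc.2.1, hc.1, ?_⟩
      intro e he f hf
      have h1 : e = y := by
        rw [List.getLast?_append_of_ne_nil _ (by simp)] at m5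
        simpa [m5, eq_comm] using he
      have h2 : f = x := by
        rw [List.head?_append_of_ne_nil _ (by rintro rfl; simp at hf)] at m4
        simpa [m4, eq_comm] using hf
      exact h1 ▸ h2 ▸ Or.inr m6
    · intro v hv w hw
      exact hrot.mem_iff.2 (m2.closed v (hrot.mem_iff.1 hv) w hw)
    · have h1 := defect_append_le F (x' :: C) B
      have h2 := defect_add_le F B (x' :: C)
      omega
  obtain ⟨v, C, hC, hCd⟩ := exists_hamiltonianCycle hF m2 m4 m5 m6
    (fun v => hperm.mem_iff.2 (hall v))
  exact ⟨v, C, hC, by omega⟩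

/-- Starting from a single component of `F`, paths are made longer until one closes to a Hamilton
cycle. -/
theorem IsClusterSystem.exists_hamiltonianCycle [Nonempty V]
    (hS : IsClusterSystem F H A σ Q N q) (hF : F.IsRegularOfDegree 2)
    (hN : 8 * Nat.card F.ConnectedComponent ≤ N) :
    ∃ (v : V) (C : (F ⊔ H).Walk v v), C.IsHamiltonianCycle ∧
      (symmDiff C.edges.toFinset F.edgeFinset).card ≤ 16 * Nat.card F.ConnectedComponent := by
  have key : ∀ (k : ℕ) (p : List V), IsClosedPath F H p → p ≠ [] →
      defect F p + 8 ≤ 8 * componentCount F p → Fintype.card V ≤ p.length + k →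
      ∃ (v : V) (C : (F ⊔ H).Walk v v), C.IsHamiltonianCycle ∧
        (symmDiff C.edges.toFinset F.edgeFinset).card ≤
          16 * Nat.card F.ConnectedComponent := by
    intro k
    induction k with
    | zero =>
      intro p hp hne hd hk
      refine (hS.hamiltonian_or_longer hF hN hp hne hd).resolve_right ?_
      rintro ⟨p', hp', hl, -⟩
      have := hp'.nodup.length_le_card
      omega
    | succ k ih =>
      intro p hp hne hd hk
      rcases hS.hamiltonian_or_longer hF hN hp hne hd with h | ⟨p', hp', hl, hd'⟩
      · exact h
      · exact ih p' hp' (List.ne_nil_of_length_pos (by omega)) hd' (by omega)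
  obtain ⟨y⟩ := ‹Nonempty V›
  obtain ⟨c, hcn, hcc, hcy, hcm⟩ := exists_component_path hF y
  have hne : c ≠ [] := by
    rintro rfl
    simp at hcy
  refine key (Fintype.card V) c ⟨hcn, hcc.imp fun _ _ h => Or.inl h, ?_⟩ hne ?_ (by omega)
  · intro v hv w hw
    exact (hcm w).2 (((hcm v).1 hv).trans hw.reachable)
  · have := componentCount_pos (F := F) hne
    rw [defect_eq_zero F hcc]
    omega

end Absorbing

/-! ### From regularity to a cluster system -/

section Regularity

variable {V : Type*} [DecidableEq V] {H : SimpleGraph V} [DecidableRel H.Adj]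

lemma IsSuperRegularPair.symm {ε d : ℝ} {A B : Finset V} (h : IsSuperRegularPair H ε d A B) :
    IsSuperRegularPair H ε d B A :=
  ⟨h.1.symm, h.2.2, h.2.1⟩

lemma IsSuperRegularPair.card_interedges_ge {ε d : ℝ} {A B : Finset V}
    (h : IsSuperRegularPair H ε d A B) {S T : Finset V} (hS : S ⊆ A) (hT : T ⊆ B)
    (hSn : S.Nonempty) (hTn : T.Nonempty)
    (hSA : ε * A.card ≤ S.card) (hTB : ε * B.card ≤ T.card) :
    (d - ε) * (S.card * T.card) ≤ (H.interedges S T).card := by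
  have hu := h.1 hS hT (by rwa [mul_comm]) (by rwa [mul_comm])
  have hA : (0 : ℝ) < A.card := by exact_mod_cast (hSn.mono hS).card_pos
  have hB : (0 : ℝ) < B.card := by exact_mod_cast (hTn.mono hT).card_pos
  have hS0 : (0 : ℝ) < S.card := by exact_mod_cast hSn.card_pos
  have hT0 : (0 : ℝ) < T.card := by exact_mod_cast hTn.card_pos
  have hdens : ∀ S T : Finset V, ((H.edgeDensity S T : ℚ) : ℝ) =
      (H.interedges S T).card / (S.card * T.card) := by
    intro S T
    rw [SimpleGraph.edgeDensity_def]
    push_cast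
    rfl
  rw [hdens, hdens] at hu
  have h1 : d ≤ (H.interedges A B).card / (A.card * B.card : ℝ) := by
    rw [le_div_iff₀ (by positivity), card_interedges_eq_sum, Nat.cast_sum]
    have := Finset.card_nsmul_le_sum A
      (fun a => ((B.filter fun b => H.Adj a b).card : ℝ)) (d * B.card) h.2.1
    rw [nsmul_eq_mul] at this
    linarith
  have h2 := (abs_lt.1 hu).1
  rw [← le_div_iff₀ (by positivity)]
  linarith

/-- In a super-regular pair, a set to which every vertex of the other class sends few edges is
small. -/
lemma IsSuperRegularPair.card_lt_of_sparse {ε d x : ℝ} {A B : Finset V}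
    (h : IsSuperRegularPair H ε d A B) (hε : ε ≤ 1) (hA : A.Nonempty) {T : Finset V} (hT : T ⊆ B)
    {δ : ℝ} (hδ : ∀ v ∈ A, ((T.filter fun w => H.Adj v w).card : ℝ) ≤ δ)
    (hx : 0 < x) (hxB : ε * B.card ≤ x) (hd : ε < d) (hδx : δ < (d - ε) * x) :
    (T.card : ℝ) < x := by
  by_contra! hcon
  have hT0 : (0 : ℝ) < T.card := hx.trans_le hcon
  have hA0 : (0 : ℝ) < A.card := by exact_mod_cast hA.card_pos
  have h1 := h.card_interedges_ge (Finset.Subset.refl A) hT hA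
    (Finset.card_pos.1 (by exact_mod_cast hT0)) (by nlinarith) (hxB.trans hcon)
  rw [card_interedges_eq_sum, Nat.cast_sum] at h1
  have h2 := Finset.sum_le_card_nsmul A
    (fun a => ((T.filter fun b => H.Adj a b).card : ℝ)) δ hδ
  rw [nsmul_eq_mul] at h2
  have h3 : (d - ε) * x ≤ (d - ε) * T.card := by nlinarith
  have h4 : A.card * δ < A.card * ((d - ε) * T.card) := by
    apply mul_lt_mul_of_pos_left _ hA0
    linarith
  linarith

lemma exists_common_of_ncard {k : ℕ} {P P' : Fin k → Prop}
    (h : k < Set.ncard {j | P j} + Set.ncard {j | P' j}) : ∃ j, P j ∧ P' j := by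
  by_contra! hcon
  have hdisj : Disjoint {j | P j} {j | P' j} :=
    Set.disjoint_left.2 fun j h1 h2 => hcon j h1 h2
  have h1 := Set.ncard_union_eq hdisj (Set.toFinite _) (Set.toFinite _)
  have h2 := Set.ncard_le_ncard (Set.subset_univ ({j | P j} ∪ {j | P' j})) (Set.toFinite _)
  rw [Set.ncard_univ, Nat.card_fin] at h2
  omega

end Regularity

section Hierarchy

/-- The function which makes the hierarchy of constants precise. The first term takes care of the
constants `ε ≪ β ≪ γ ≪ α`; the second one forces `(log n) ^ (1 / 5) ≥ 100 k ^ 5`. -/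
noncomputable def hierarchyBound (x : ℝ) : ℝ :=
  min (x ^ 2 / 1000) (Real.exp (-(100 * x⁻¹ ^ 5) ^ 5))

lemma hierarchyBound_pos {x : ℝ} (hx : 0 < x) : 0 < hierarchyBound x :=
  lt_min (by positivity) (Real.exp_pos _)

lemma le_log_of_le_hierarchyBound {n k : ℕ} (hn : 0 < n)
    (h : 1 / (n : ℝ) ≤ hierarchyBound (1 / (k : ℝ))) :
    100 * (k : ℝ) ^ 5 ≤ Real.log n ^ (1 / 5 : ℝ) := by
  have hn' : (0 : ℝ) < n := by exact_mod_cast hn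
  have h1 : 1 / (n : ℝ) ≤ Real.exp (-(100 * (k : ℝ) ^ 5) ^ 5) := by
    refine h.trans ((min_le_right _ _).trans_eq ?_)
    rw [one_div, inv_inv]
  have h2 : (100 * (k : ℝ) ^ 5) ^ 5 ≤ Real.log n := by
    have := Real.log_le_log (by positivity) h1
    rw [Real.log_exp, one_div, Real.log_inv] at this
    linarith
  calc 100 * (k : ℝ) ^ 5 = ((100 * (k : ℝ) ^ 5) ^ 5) ^ (1 / 5 : ℝ) := by
        rw [show (1 / 5 : ℝ) = ((5 : ℕ) : ℝ)⁻¹ by norm_num,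
          Real.pow_rpow_inv_natCast (by positivity) (by norm_num)]
    _ ≤ _ := Real.rpow_le_rpow (by positivity) h2 (by norm_num)

/-- With few components, the number `N` of admissible non-`F` steps is tiny compared with the size
of the clusters. -/
lemma steps_le {c n m k : ℕ} {ε : ℝ} (hn : 0 < n) (hk : 0 < k) (hε : ε ≤ 1 / 2)
    (hnk : 1 / (n : ℝ) ≤ hierarchyBound (1 / (k : ℝ)))
    (hm : (1 - ε) * (n : ℝ) ≤ (m : ℝ) * (k : ℝ))
    (hc : (c : ℝ) ≤ (n : ℝ) / (Real.log (n : ℝ)) ^ (1 / 5 : ℝ)) :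
    25 * ((8 * c : ℕ) : ℝ) * (k : ℝ) ^ 4 ≤ 4 * m := by
  have hlog := le_log_of_le_hierarchyBound hn hnk
  have hk' : (0 : ℝ) < k := by exact_mod_cast hk
  have hn' : (0 : ℝ) < n := by exact_mod_cast hn
  have h1 : (n : ℝ) ≤ 2 * (m * k) := by nlinarith
  have h2 : (c : ℝ) * (100 * (k : ℝ) ^ 5) ≤ n := by
    rw [← le_div_iff₀ (by positivity)]
    exact hc.trans (div_le_div_of_nonneg_left hn'.le (by positivity) hlog)
  have h3 : (25 * ((8 * c : ℕ) : ℝ) * (k : ℝ) ^ 4) * k ≤ (4 * m) * k := by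
    push_cast
    nlinarith
  exact le_of_mul_le_mul_right h3 hk'

end Hierarchy

section ClusterSystem

variable {V : Type*} [Fintype V] [DecidableEq V] {F H : SimpleGraph V} [DecidableRel F.Adj]
  [DecidableRel H.Adj]

/-- The pairing of the clusters given by the enumeration `B₁, …, B_k', D₁, …, D_k'`. -/
def partner {k k' : ℕ} (e : Fin k' ⊕ Fin k' ≃ Fin k) (i : Fin k) : Fin k :=
  e (e.symm i).swap

lemma partner_partner {k k' : ℕ} (e : Fin k' ⊕ Fin k' ≃ Fin k) (i : Fin k) :
    partner e (partner e i) = i := by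
  simp [partner]

/-- The degree condition on the clusters forces `α ≤ 1`, as there are only `2 k'` clusters. -/
lemma le_one_of_le_ncard {α : ℝ} {k k' : ℕ} (hkk : k = 2 * k') (hk : 0 < k) {P : Fin k → Prop}
    (h : (1 + α) * (k' : ℝ) ≤ (Set.ncard {j | P j} : ℝ)) : α ≤ 1 := by
  have h1 := Set.ncard_le_ncard (Set.subset_univ {j | P j}) (Set.toFinite _)
  rw [Set.ncard_univ, Nat.card_fin] at h1
  replace h1 := h1.trans_eq hkk
  have h2 : (Set.ncard {j | P j} : ℝ) ≤ 2 * k' := by exact_mod_cast h1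
  have hk' : (0 : ℝ) < k' := by
    have : 0 < k' := by omega
    exact_mod_cast this
  have h3 := le_of_mul_le_mul_right (h.trans h2) hk'
  linarith

lemma hierarchy_consequences {α γ β ε : ℝ} (hα : 0 < α) (hγ : 0 < γ) (hβ : 0 < β) (hα1 : α ≤ 1)
    (hγα : γ ≤ α ^ 2 / 1000) (hβγ : β ≤ γ ^ 2 / 1000) (hεβ : ε ≤ β ^ 2 / 1000) :
    γ ≤ α / 1000 ∧ ε ≤ γ * β / 1000 ∧ γ * β ≤ α / 1000000 ∧ 2 * γ ^ 2 < α / 700 := by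
  have hα2 : α ^ 2 ≤ α := pow_le_of_le_one hα.le hα1 two_ne_zero
  have hγ1 : γ ≤ α / 1000 := by linarith
  have hγ2 : γ ^ 2 ≤ γ * (α / 1000) := by
    rw [pow_two]
    exact mul_le_mul_of_nonneg_left hγ1 hγ.le
  have hγ3 : γ * α ≤ γ := mul_le_of_le_one_right hγ.le hα1
  have hβ1 : β ≤ γ / 1000 := by linarith
  have hββ : β ^ 2 ≤ γ * β := by
    rw [pow_two]
    exact mul_le_mul_of_nonneg_right (by linarith) hβ.le
  have hγβ : γ * β ≤ γ * 1 := mul_le_mul_of_nonneg_left (by linarith) hγ.le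
  have hγβ' : γ * β ≤ γ * (γ / 1000) := mul_le_mul_of_nonneg_left hβ1 hγ.le
  exact ⟨hγ1, by linarith, by linarith, by linarith⟩

/-- The regularity hypotheses, in terms of the pairing `σ` of the clusters `A i`, yield a cluster
system. All sizes are compared with `ε m`. -/
lemma isClusterSystem_of_regular {α γ β ε : ℝ} {n k k' m c : ℕ} {A : Fin k → Finset V}
    {σ : Fin k → Fin k} (hσ : ∀ i, σ (σ i) = i) (hkk : k = 2 * k')
    (hα : 0 < α) (hγ : 0 < γ) (hβ : 0 < β) (hk : 0 < k)
    (hγα : γ ≤ α ^ 2 / 1000) (hβγ : β ≤ γ ^ 2 / 1000) (hεβ : ε ≤ β ^ 2 / 1000)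
    (hkε : 1 / (k : ℝ) ≤ ε) (hmn : (m : ℝ) * k ≤ n)
    (hc : 0 < c) (hN : 25 * ((8 * c : ℕ) : ℝ) * (k : ℝ) ^ 4 ≤ 4 * m)
    (hcard : ∀ i : Fin k, |((A i).card : ℝ) - (1 - 2 * ε) * (m : ℝ)| < 1)
    (hout : ∀ i, ∀ v ∈ A i, (((A (σ i)).filter fun w => H.Adj v w ∧ ∃ x, F.Adj w x ∧ x ∉ A i).card
      : ℝ) ≤ 2 * γ ^ 3 * β * m)
    (hreg : ∀ i, IsSuperRegularPair H (3 * ε) (γ * β / 6) (A i) (A (σ i)))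
    (hdeg : ∀ i : Fin k, (1 + α) * (k' : ℝ) ≤
      (Set.ncard {j : Fin k | IsWeaklyRegularPair H m ε (ε ^ 3 / (k : ℝ)) (A i) (A j)} : ℝ))
    (hexc : ∀ x : V, (∀ i : Fin k, x ∉ A i) →
      α * (n : ℝ) / 6 ≤ (H.degree x : ℝ) ∧ ∀ y : V, H.Adj x y → ∃ i : Fin k, y ∈ A i) :
    IsClusterSystem F H A σ
      (fun i j => IsWeaklyRegularPair H m ε (ε ^ 3 / (k : ℝ)) (A i) (A j))
      (8 * c) ⌈3 * ε * m⌉₊ := by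
  have hk1 : (1 : ℝ) ≤ k := by exact_mod_cast hk
  have hk0 : (0 : ℝ) < k := by linarith
  have hk' : (0 : ℝ) < k' := by
    have : 0 < k' := by omega
    exact_mod_cast this
  have hkk' : (k : ℝ) = 2 * k' := by exact_mod_cast hkk
  have hε : 0 < ε := lt_of_lt_of_le (by positivity) hkε
  have hα1 : α ≤ 1 := le_one_of_le_ncard hkk hk (hdeg ⟨0, hk⟩)
  obtain ⟨hγ1, hε1, hγβ, hγsq⟩ := hierarchy_consequences hα hγ hβ hα1 hγα hβγ hεβ
  have hεα : ε ≤ α / 1000000000 := by linarith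
  have hN8 : (8 : ℝ) ≤ ((8 * c : ℕ) : ℝ) := by
    have : 8 ≤ 8 * c := by omega
    exact_mod_cast this
  set N : ℕ := 8 * c with hNdef
  have hm0 : (0 : ℝ) < m := by
    have : 0 < 25 * (N : ℝ) * (k : ℝ) ^ 4 := by positivity
    linarith
  have hkε1 : 1 ≤ k * ε := by
    rw [div_le_iff₀ hk0] at hkε
    linarith
  have hNε : 25 * (N : ℝ) ≤ 4 * (ε * m) := by
    have h1 : 25 * (N : ℝ) * k ≤ 25 * (N : ℝ) * k ^ 4 :=
      mul_le_mul_of_nonneg_left (le_self_pow₀ hk1 (by norm_num)) (by positivity)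
    have h2 : 25 * (N : ℝ) * (k * ε) ≤ 4 * (ε * m) := by
      have := mul_le_mul_of_nonneg_right (h1.trans hN) hε.le
      linarith
    have h3 : 25 * (N : ℝ) * 1 ≤ 25 * (N : ℝ) * (k * ε) :=
      mul_le_mul_of_nonneg_left hkε1 (by positivity)
    linarith
  have hεm : 50 ≤ ε * m := by linarith
  set q : ℕ := ⌈3 * ε * m⌉₊ with hq
  have hq1 : 3 * ε * m ≤ q := Nat.le_ceil _
  have hq2 : (q : ℝ) < 3 * ε * m + 1 := Nat.ceil_lt_add_one (by positivity)
  have hq0 : 0 < q := Nat.ceil_pos.2 (by positivity)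
  have hbound : ((2 * N + 2 * q + 2 : ℕ) : ℝ) ≤ 7 * (ε * m) := by
    push_cast
    linarith
  have hAle : ∀ i, ((A i).card : ℝ) ≤ m := by
    intro i
    have := (abs_lt.1 (hcard i)).2
    linarith
  have hAge : ∀ i, (1 - 3 * ε) * m ≤ ((A i).card : ℝ) := by
    intro i
    have := (abs_lt.1 (hcard i)).1
    linarith
  have hAne : ∀ i, (A i).Nonempty := by
    intro i
    have h1 := hAge i
    have h2 : 0 < (1 - 3 * ε) * m := by
      apply mul_pos _ hm0
      linarith
    exact Finset.card_pos.1 (by exact_mod_cast h2.trans_le h1)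
  -- vertices of a cluster with an `F`-neighbour outside the partner cluster
  set bad : Fin k → Finset V := fun j => (A j).filter fun w => ∃ x, F.Adj w x ∧ x ∉ A (σ j)
    with hbad
  have hbadc : ∀ j, ((bad j).card : ℝ) < α * m / 100 := by
    intro j
    have hr := (hreg j).symm
    refine hr.card_lt_of_sparse (δ := 2 * γ ^ 3 * β * m) (by linarith) (hAne _)
      (Finset.filter_subset _ _) ?_ (by positivity) ?_ (by linarith) ?_
    · intro v hv
      have h1 := hout (σ j) v hv
      rw [hσ] at h1
      refine le_trans ?_ h1
      rw [Finset.filter_filter]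
      exact_mod_cast Finset.card_le_card fun w hw => by
        simp only [Finset.mem_filter] at hw ⊢
        exact ⟨hw.1, hw.2.2, hw.2.1⟩
    · have h1 := mul_le_mul_of_nonneg_left (hAle j) (show 0 ≤ 3 * ε by positivity)
      have h2 := mul_le_mul_of_nonneg_right hεα hm0.le
      have h3 : 0 < α * m := by positivity
      linarith
    · have h1 : γ * β / 7 * (α * m / 100) ≤ (γ * β / 6 - 3 * ε) * (α * m / 100) :=
        mul_le_mul_of_nonneg_right (by linarith) (by positivity)
      refine lt_of_lt_of_le ?_ h1
      have h3 := mul_lt_mul_of_pos_left hγsq (show 0 < γ * β * m by positivity)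
      linarith
  have hinner : ∀ j, (A j).card ≤
      ((A j).filter fun w => ∀ u, F.Adj w u → u ∈ A (σ j)).card + (bad j).card := by
    intro j
    refine le_trans (Finset.card_le_card fun w hw => ?_) (Finset.card_union_le _ _)
    simp only [hbad, Finset.mem_union, Finset.mem_filter]
    by_cases h : ∀ u, F.Adj w u → u ∈ A (σ j)
    · exact Or.inl ⟨hw, h⟩
    · push Not at h
      exact Or.inr ⟨hw, h⟩
  have htyp : ∀ a, ∀ v ∈ A a, 2 * N + 2 * q + 2 ≤ (typicalNeighbors F H A σ a v).card := by
    intro a v hv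
    have h1 := (hreg a).2.1 v hv
    have h2 := hout a v hv
    have h3 : ((A (σ a)).filter fun w => H.Adj v w).card ≤
        (typicalNeighbors F H A σ a v).card +
          ((A (σ a)).filter fun w => H.Adj v w ∧ ∃ x, F.Adj w x ∧ x ∉ A a).card := by
      refine le_trans (Finset.card_le_card fun w hw => ?_) (Finset.card_union_le _ _)
      simp only [typicalNeighbors, Finset.mem_union, Finset.mem_filter] at hw ⊢
      by_cases h : ∀ u, F.Adj w u → u ∈ A a
      · exact Or.inl ⟨hw.1, hw.2, h⟩
      · push Not at h
        exact Or.inr ⟨hw.1, hw.2, h⟩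
    have h4 : γ * β / 7 * m ≤ γ * β / 6 * ((A (σ a)).card : ℝ) := by
      have h5 := hAge (σ a)
      have h6 : γ * β / 6 * ((1 - 3 * ε) * m) ≤ γ * β / 6 * ((A (σ a)).card : ℝ) :=
        mul_le_mul_of_nonneg_left h5 (by positivity)
      have h7 : 6 / 7 * (γ * β / 6 * m) ≤ (1 - 3 * ε) * (γ * β / 6 * m) :=
        mul_le_mul_of_nonneg_right (by linarith) (by positivity)
      linarith
    have h5 : 2 * γ ^ 3 * β * m ≤ γ * β / 100 * m := by
      have h6 : 2 * γ ^ 2 ≤ 1 / 100 := by linarith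
      have h7 := mul_le_mul_of_nonneg_left h6 (show 0 ≤ γ * β * m by positivity)
      linarith
    have h6 : 1000 * (ε * m) ≤ γ * β * m := by
      have := mul_le_mul_of_nonneg_right hε1 hm0.le
      linarith
    have h7 : (((A (σ a)).filter fun w => H.Adj v w).card : ℝ) ≤
        (typicalNeighbors F H A σ a v).card +
          ((A (σ a)).filter fun w => H.Adj v w ∧ ∃ x, F.Adj w x ∧ x ∉ A a).card := by
      exact_mod_cast h3
    have h8 : ((2 * N + 2 * q + 2 : ℕ) : ℝ) ≤ (typicalNeighbors F H A σ a v).card := by linarith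
    exact_mod_cast h8
  have hhalf : ∀ i, k < 2 * (Set.ncard {j : Fin k |
      IsWeaklyRegularPair H m ε (ε ^ 3 / (k : ℝ)) (A i) (A j)}) := by
    intro i
    have h1 := hdeg i
    have h2 : (k : ℝ) < 2 * (Set.ncard {j : Fin k |
        IsWeaklyRegularPair H m ε (ε ^ 3 / (k : ℝ)) (A i) (A j)} : ℝ) := by
      have : 0 < α * k' := by positivity
      linarith
    exact_mod_cast h2
  refine ⟨hσ, hq0, ?_, htyp, ?_, ?_, ?_, ?_, ?_⟩
  · intro v
    by_cases hv : ∃ i, v ∈ A i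
    · obtain ⟨i, hi⟩ := hv
      exact ⟨i, htyp i v hi⟩
    push Not at hv
    obtain ⟨h1, h2⟩ := hexc v hv
    -- by averaging, some cluster contains many neighbours of the exceptional vertex `v`
    have h3 : ∃ j, α * m / 6 ≤ (((A j).filter fun w => H.Adj v w).card : ℝ) := by
      by_contra! hcon
      have h4 : (H.degree v : ℝ) ≤ ∑ j, (((A j).filter fun w => H.Adj v w).card : ℝ) := by
        have : H.degree v ≤ ∑ j, ((A j).filter fun w => H.Adj v w).card := by
          rw [← H.card_neighborFinset_eq_degree]
          refine le_trans (Finset.card_le_card fun w hw => ?_) Finset.card_biUnion_le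
          rw [SimpleGraph.mem_neighborFinset] at hw
          obtain ⟨i, hi⟩ := h2 w hw
          exact Finset.mem_biUnion.2 ⟨i, Finset.mem_univ _, Finset.mem_filter.2 ⟨hi, hw⟩⟩
        exact_mod_cast this
      have h5 : ∑ j, (((A j).filter fun w => H.Adj v w).card : ℝ) <
          ∑ _j : Fin k, α * m / 6 :=
        Finset.sum_lt_sum_of_nonempty ⟨⟨0, hk⟩, Finset.mem_univ _⟩ fun j _ => hcon j
      rw [Finset.sum_const, Finset.card_univ, Fintype.card_fin, nsmul_eq_mul] at h5
      have h6 := mul_le_mul_of_nonneg_left hmn hα.le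
      linarith
    obtain ⟨j, hj⟩ := h3
    refine ⟨σ j, ?_⟩
    have h4 : ((A j).filter fun w => H.Adj v w).card ≤
        (typicalNeighbors F H A σ (σ j) v).card + (bad j).card := by
      refine le_trans (Finset.card_le_card fun w hw => ?_) (Finset.card_union_le _ _)
      simp only [typicalNeighbors, hbad, hσ, Finset.mem_union, Finset.mem_filter] at hw ⊢
      by_cases h : ∀ u, F.Adj w u → u ∈ A (σ j)
      · exact Or.inl ⟨hw.1, hw.2, h⟩
      · push Not at h
        exact Or.inr ⟨hw.1, h⟩
    have h5 : (((A j).filter fun w => H.Adj v w).card : ℝ) ≤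
        (typicalNeighbors F H A σ (σ j) v).card + (bad j).card := by exact_mod_cast h4
    have h6 := hbadc j
    have h7 : 1000 * (ε * m) ≤ α * m := by
      have := mul_le_mul_of_nonneg_right hεα hm0.le
      have : 0 < α * m := by positivity
      linarith
    have h8 : ((2 * N + 2 * q + 2 : ℕ) : ℝ) ≤ (typicalNeighbors F H A σ (σ j) v).card := by
      linarith
    exact_mod_cast h8
  · intro a j haj S hS T hT hSq hTq
    have hle : ε * m ≤ 3 * ε * m := by linarith
    have h1 := haj S hS T hT ((hle.trans hq1).trans (by exact_mod_cast hSq))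
      ((hle.trans hq1).trans (by exact_mod_cast hTq))
    have h2 : (S.card : ℝ) ≤ m :=
      le_trans (by exact_mod_cast Finset.card_le_card hS) (hAle a)
    have h3 : (N : ℝ) < ε ^ 3 / k * m := by
      have h4 : 1 ≤ (k * ε) ^ 3 := one_le_pow₀ hkε1
      rw [div_mul_eq_mul_div, lt_div_iff₀ hk0]
      -- multiplied by `k ^ 3`, this is the bound on `N`
      have h5 : N * k * (k : ℝ) ^ 3 < ε ^ 3 * m * (k : ℝ) ^ 3 := by
        have h6 := mul_le_mul_of_nonneg_right h4 hm0.le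
        linarith
      exact lt_of_mul_lt_mul_right h5 (by positivity)
    have h6 : (N : ℝ) * S.card < (H.interedges S T).card := by
      refine lt_of_lt_of_le ?_ h1
      calc (N : ℝ) * S.card ≤ N * m := mul_le_mul_of_nonneg_left h2 (by positivity)
        _ < ε ^ 3 / k * m * m := mul_lt_mul_of_pos_right h3 hm0
        _ = _ := by ring
    exact_mod_cast h6
  · intro a S hS T hT hSq hTq
    have hs : ∀ i, ∀ S : Finset V, q ≤ S.card → 3 * ε * ((A i).card : ℝ) ≤ S.card := by
      intro i S hSq
      have h1 : (q : ℝ) ≤ S.card := by exact_mod_cast hSq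
      have h2 := mul_le_mul_of_nonneg_left (hAle i) (show 0 ≤ 3 * ε by positivity)
      linarith
    have hSn : 0 < S.card := by omega
    have hTn : 0 < T.card := by omega
    have h1 := (hreg a).card_interedges_ge hS hT (Finset.card_pos.1 hSn) (Finset.card_pos.1 hTn)
      (hs a S hSq) (hs _ T hTq)
    have h2 : 0 < (γ * β / 6 - 3 * ε) * ((S.card : ℝ) * T.card) := by
      have h3 : (0 : ℝ) < S.card := by exact_mod_cast hSn
      have h4 : (0 : ℝ) < T.card := by exact_mod_cast hTn
      have h5 : 0 < γ * β := by positivity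
      have h6 : 0 < γ * β / 6 - 3 * ε := by linarith
      positivity
    obtain ⟨x, hx⟩ := Finset.card_pos.1 (show 0 < (H.interedges S T).card by
      exact_mod_cast h2.trans_le h1)
    rw [SimpleGraph.interedges, Rel.mem_interedges_iff] at hx
    exact ⟨x.1, hx.1, x.2, hx.2.1, hx.2.2⟩
  · intro a b
    refine exists_common_of_ncard (P := fun j => IsWeaklyRegularPair H m ε (ε ^ 3 / (k : ℝ))
      (A a) (A (σ j))) ?_
    have h1 := hhalf a
    have h2 := hhalf b
    have h3 : Set.ncard {j : Fin k | IsWeaklyRegularPair H m ε (ε ^ 3 / (k : ℝ))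
        (A a) (A j)} ≤ Set.ncard {j : Fin k | IsWeaklyRegularPair H m ε (ε ^ 3 / (k : ℝ))
        (A a) (A (σ j))} := by
      refine Set.ncard_le_ncard_of_injOn σ (fun j hj => ?_)
        (Function.LeftInverse.injective hσ).injOn (Set.toFinite _)
      simpa [hσ] using hj
    omega
  · intro a b
    refine exists_common_of_ncard ?_
    have h1 := hhalf a
    have h2 := hhalf b
    omega
  · intro j
    have h1 : ((A j).card : ℝ) ≤
        ((A j).filter fun w => ∀ u, F.Adj w u → u ∈ A (σ j)).card + (bad j).card := by
      exact_mod_cast hinner j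
    have h2 := hbadc j
    have h3 := hAge j
    have h4 : ε * m ≤ 1 / 1000 * m := mul_le_mul_of_nonneg_right (by linarith) hm0.le
    have h5 : α * m ≤ 1 * m := mul_le_mul_of_nonneg_right hα1 hm0.le
    have h6 : (q : ℝ) ≤ ((A j).filter fun w => ∀ u, F.Adj w u → u ∈ A (σ j)).card := by
      linarith
    exact_mod_cast h6

end ClusterSystem

/-! ### The Hamilton cycle close to the 2-factor -/

theorem mainTheorem6 :
    -- the hierarchy `1/n ≪ 1/k ≤ ε ≪ β ≪ γ ≪ α`: `a ≪ b` is read as `a ≤ f b`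
    ∃ f : ℝ → ℝ, (∀ x : ℝ, 0 < x → 0 < f x) ∧
    ∀ (α γ β ε : ℝ) (n k k' m : ℕ),
      0 < α → 0 < γ → 0 < β → 0 < ε → 0 < k → 0 < n →
      γ ≤ f α → β ≤ f γ → ε ≤ f β → 1 / (k : ℝ) ≤ ε → 1 / (n : ℝ) ≤ f (1 / (k : ℝ)) →
      (1 - ε) * (n : ℝ) ≤ (m : ℝ) * (k : ℝ) → (m : ℝ) * (k : ℝ) ≤ (n : ℝ) →
    ∀ (V : Type*) [Fintype V] [DecidableEq V]
      (F H : SimpleGraph V) [DecidableRel F.Adj] [DecidableRel H.Adj]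
      (A : Fin k → Finset V) (B D : Fin k' → Finset V) (e : Fin k' ⊕ Fin k' ≃ Fin k),
      Fintype.card V = n →
      -- `F` is a 2-factor, edge-disjoint from `H`
      F.IsRegularOfDegree 2 →
      Disjoint F.edgeSet H.edgeSet →
      -- the clusters are disjoint and of size `(1 - 2 ε) m`, up to rounding
      (∀ i j : Fin k, i ≠ j → Disjoint (A i) (A j)) →
      (∀ i : Fin k, |((A i).card : ℝ) - (1 - 2 * ε) * (m : ℝ)| < 1) →
      -- `B_1, …, B_k', D_1, …, D_k'` is another enumeration of the clusters
      (∀ i : Fin k', B i = A (e (Sum.inl i))) →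
      (∀ i : Fin k', D i = A (e (Sum.inr i))) →
      -- (i)
      ((Nat.card F.ConnectedComponent : ℝ) ≤ (n : ℝ) / (Real.log (n : ℝ)) ^ (1 / 5 : ℝ)) →
      -- (ii)
      (∀ i : Fin k',
        (∀ b ∈ B i,
          (((D i).filter fun d => H.Adj b d ∧ ∃ x, F.Adj d x ∧ x ∉ B i).card : ℝ)
            ≤ 2 * γ ^ 3 * β * (m : ℝ)) ∧
        (∀ d ∈ D i,
          (((B i).filter fun b => H.Adj d b ∧ ∃ x, F.Adj b x ∧ x ∉ D i).card : ℝ)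
            ≤ 2 * γ ^ 3 * β * (m : ℝ))) →
      -- (iii)
      (∀ i : Fin k', IsSuperRegularPair H (3 * ε) (γ * β / 6) (B i) (D i)) →
      -- (iv)
      (∀ i : Fin k, (1 + α) * (k' : ℝ) ≤
        (Set.ncard {j : Fin k | IsWeaklyRegularPair H m ε (ε ^ 3 / (k : ℝ)) (A i) (A j)} : ℝ)) →
      -- (v)
      (∀ i j : Fin k, i < j → (∃ a ∈ A i, ∃ b ∈ A j, (F ⊔ H).Adj a b) →
        IsWeaklyRegularPair H m ε (ε ^ 3 / (k : ℝ)) (A i) (A j)) →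
      -- (vi)
      (∀ x : V, (∀ i : Fin k, x ∉ A i) → ∀ y : V, F.Adj x y → ∃ i : Fin k, y ∈ A i) →
      -- (vii)
      (∀ x : V, (∀ i : Fin k, x ∉ A i) →
        α * (n : ℝ) / 6 ≤ (H.degree x : ℝ) ∧ ∀ y : V, H.Adj x y → ∃ i : Fin k, y ∈ A i) →
      ∃ (v : V) (C : (F ⊔ H).Walk v v), C.IsHamiltonianCycle ∧
        ((symmDiff C.edges.toFinset F.edgeFinset).card : ℝ)
          ≤ 25 * (n : ℝ) / (Real.log (n : ℝ)) ^ (1 / 5 : ℝ) := by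
  refine ⟨hierarchyBound, fun x => hierarchyBound_pos, ?_⟩
  intro α γ β ε n k k' m hα hγ hβ hε hk hn hγα hβγ hεβ hkε hnk hm hmn V _ _ F H _ _ A B D e hV hF
    _ _ hcard hB hD hcomp hout hreg hdeg _ _ hexc
  have hkk : k = 2 * k' := by
    have := Fintype.card_congr e
    simp only [Fintype.card_sum, Fintype.card_fin] at this
    omega
  have hγα' := hγα.trans (min_le_left _ _)
  have hβγ' := hβγ.trans (min_le_left _ _)
  have hεβ' := hεβ.trans (min_le_left _ _)
  have : Nonempty V := Fintype.card_pos_iff.1 (by omega)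
  have hc : 0 < Nat.card F.ConnectedComponent := Nat.card_pos
  have hσ := partner_partner e
  -- a property of the pairs `(B i, D i)` and `(D i, B i)` holds for all pairs of partners
  have hpair : ∀ P : Finset V → Finset V → Prop, (∀ i, P (B i) (D i) ∧ P (D i) (B i)) →
      ∀ i, P (A i) (A (partner e i)) := by
    intro P hP i
    obtain ⟨j, rfl⟩ := e.surjective i
    rcases j with j | j
    · simpa [partner, hB, hD] using (hP j).1
    · simpa [partner, hB, hD] using (hP j).2
  have hε2 : ε ≤ 1 / 2 := by
    have hα1 := le_one_of_le_ncard hkk hk (hdeg ⟨0, hk⟩)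
    obtain ⟨-, h1, h2, -⟩ := hierarchy_consequences hα hγ hβ hα1 hγα' hβγ' hεβ'
    linarith
  have hS := isClusterSystem_of_regular (F := F) (c := Nat.card F.ConnectedComponent) hσ hkk hα hγ
    hβ hk hγα' hβγ' hεβ' hkε hmn hc (steps_le hn hk hε2 hnk hm hcomp) hcard
    (hpair (fun S T => ∀ v ∈ S, ((T.filter fun w => H.Adj v w ∧ ∃ x, F.Adj w x ∧ x ∉ S).card : ℝ)
      ≤ 2 * γ ^ 3 * β * m) hout)
    (hpair (IsSuperRegularPair H (3 * ε) (γ * β / 6)) fun i => ⟨hreg i, (hreg i).symm⟩) hdeg hexc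
  obtain ⟨v, C, hC, hCd⟩ := hS.exists_hamiltonianCycle hF le_rfl
  refine ⟨v, C, hC, ?_⟩
  have h1 : ((symmDiff C.edges.toFinset F.edgeFinset).card : ℝ) ≤
      16 * (Nat.card F.ConnectedComponent : ℝ) := by exact_mod_cast hCd
  have h3 : (0 : ℝ) ≤ Nat.card F.ConnectedComponent := Nat.cast_nonneg _
  rw [mul_div_assoc]
  linarith
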